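/- Let $E$ and $F$ be Banach spaces over $\mathbb{R}$ (or over $\mathbb{C}$) and let $T:E\to F$ be a continuous linear operator. Write $\overline{B}_E$ and $S_E$ for the closed unit ball and the unit sphere of $E$, and $\rho_T(e)=\|Te\|$ for the semi-norm on $E$ induced by $T$. A sequence $(e_n)_{n\in\mathbb N}$ in $E$ is *basic* if it is a Schauder basis of its closed linear span, and *normalized* if it lies in $S_E$; it is *$\rho_T$-null* if $\rho_T(e_n)\to 0$. $T$ is *bounded from below* on a subspace $G$ if there is $c>0$ with $\|Tx\|\ge c\|x\|$ for all $x\in G$. Subspaces are not assumed to be closed. $T$ is *complementary* to a topology $\tau$ on $E$ if the weakest topology on $E$ that is stronger than both $\tau$ and the topology generated by $\rho_T$ is the norm topology. The following conditions are equivalent: (i) $T$ is upper semi-Fredholm, i.e. it has a finite-dimensional kernel and a closed range; (ii) there is a subspace of $E$ of finite codimension on which $T$ is bounded from below; (iii) $\dim\operatorname{Ker}(T-S)<\infty$ for every compact operator $S:E\to F$; (iv) no restriction of $T$ to an infinite-dimensional subspace of $E$ is compact; (v) $T|_{\overline{B}_E}$ is proper, i.e. $T^{-1}(K)\cap\overline{B}_E$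 is compact for every compact $K\subset F$; (vi) $T|_{\overline{B}_E}$ is closed, i.e. $T(A)$ is closed for every closed $A\subset\overline{B}_E$, and moreover $T\neq 0$ unless $E$ is finite-dimensional; (vii) every sequence $(e_n)$ in $S_E$ for which $(Te_n)$ converges in $F$ has a convergent subsequence; (viii) every normalized $\rho_T$-null sequence in $E$ has a convergent subsequence; (ix) no normalized basic sequence in $E$ is $\rho_T$-null; (x) for every basic sequence $(e_n)$ in $E$ there is $m\in\mathbb N$ such that $T$ is bounded from below on $\overline{\operatorname{span}}\{e_n\}_{n\ge m}$; (xi) for every basic sequence $(e_n)$ in $E$ the restriction of $T$ to $\overline{\operatorname{span}}\{e_n\}_{n\in\mathbb N}$ is not compact; (xii) whenever $H$ is a normed space and $S:H\to E$ is a continuous linear operator such that $TS$ is compact, $S$ is compact; (xiii) $T$ is complementary to the weak topology on $E$. -/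

import Mathlib

open Filter Topology

universe u w

noncomputable section

/-- `T` is upper semi-Fredholm: its kernel is finite-dimensional and its range is closed. -/
def IsUpperSemiFredholm {𝕜 E F : Type*} [RCLike 𝕜]
    [NormedAddCommGroup E] [NormedSpace 𝕜 E] [NormedAddCommGroup F] [NormedSpace 𝕜 F]
    (T : E →L[𝕜] F) : Prop :=
  FiniteDimensional 𝕜 (LinearMap.ker (T : E →ₗ[𝕜] F)) ∧ IsClosed (Set.range T)

/-- `T` is bounded from below on the subspace `G`. -/
def IsBoundedBelowOn {𝕜 E F : Type*} [RCLike 𝕜]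
    [NormedAddCommGroup E] [NormedSpace 𝕜 E] [NormedAddCommGroup F] [NormedSpace 𝕜 F]
    (T : E →L[𝕜] F) (G : Submodule 𝕜 E) : Prop :=
  ∃ c : ℝ, 0 < c ∧ ∀ x ∈ G, c * ‖x‖ ≤ ‖T x‖

/-- The restriction of `T` to the subspace `G` is a compact operator. -/
def IsCompactOn {𝕜 E F : Type*} [RCLike 𝕜]
    [NormedAddCommGroup E] [NormedSpace 𝕜 E] [NormedAddCommGroup F] [NormedSpace 𝕜 F]
    (T : E →L[𝕜] F) (G : Submodule 𝕜 E) : Prop :=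
  IsCompactOperator (fun x : G => T (x : E))

/-- The closed linear span of the set `s`. -/
def closedSpan (𝕜 : Type*) {E : Type*} [RCLike 𝕜] [NormedAddCommGroup E] [NormedSpace 𝕜 E]
    (s : Set E) : Submodule 𝕜 E :=
  (Submodule.span 𝕜 s).topologicalClosure

/-- `e` is a basic sequence: a Schauder basis of its closed linear span. -/
def IsBasicSequence (𝕜 : Type*) {E : Type*} [RCLike 𝕜]
    [NormedAddCommGroup E] [NormedSpace 𝕜 E] (e : ℕ → E) : Prop :=
  ∃ b : SchauderBasis 𝕜 (closedSpan 𝕜 (Set.range e)),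
    ∀ n, ((b n : closedSpan 𝕜 (Set.range e)) : E) = e n

/-- The topology of the norm. -/
abbrev normTopology (E : Type*) [NormedAddCommGroup E] : TopologicalSpace E :=
  inferInstance

/-- The weak topology, as a topology on the carrier `E` itself. -/
abbrev weakTopology (𝕜 E : Type*) [RCLike 𝕜] [NormedAddCommGroup E] [NormedSpace 𝕜 E] :
    TopologicalSpace E :=
  TopologicalSpace.induced (toWeakSpace 𝕜 E) inferInstance

/-- The topology generated by a single seminorm. -/
abbrev seminormTopology {𝕜 E : Type*} [RCLike 𝕜] [NormedAddCommGroup E] [NormedSpace 𝕜 E]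
    (ρ : Seminorm 𝕜 E) : TopologicalSpace E :=
  ρ.toAddGroupSeminorm.toSeminormedAddCommGroup.toPseudoMetricSpace.toUniformSpace.toTopologicalSpace

/-- The seminorm `x ↦ ‖T x‖` induced by an operator. -/
def operatorSeminorm {𝕜 E F : Type*} [RCLike 𝕜]
    [NormedAddCommGroup E] [NormedSpace 𝕜 E] [NormedAddCommGroup F] [NormedSpace 𝕜 F]
    (T : E →L[𝕜] F) : Seminorm 𝕜 E :=
  (normSeminorm 𝕜 F).comp (T : E →ₗ[𝕜] F)

/-- Two topologies on a normed space are complementary if together they generate the norm topology,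
i.e. the norm topology is the weakest topology that is stronger than both of them. (In Mathlib's
order on topologies, where smaller means stronger, this weakest topology is the infimum.) -/
def AreComplementary {E : Type*} [NormedAddCommGroup E] (τ π : TopologicalSpace E) : Prop :=
  τ ⊓ π = normTopology E

/-- `T` is complementary to the topology `τ` if its seminorm `x ↦ ‖T x‖` generates a topology that
is complementary to `τ`. -/
def IsComplementaryTo {𝕜 E F : Type*} [RCLike 𝕜]
    [NormedAddCommGroup E] [NormedSpace 𝕜 E] [NormedAddCommGroup F] [NormedSpace 𝕜 F]
    (T : E →L[𝕜] F) (τ : TopologicalSpace E) : Prop :=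
  AreComplementary τ (seminormTopology (operatorSeminorm T))

/-- The topology generated by the seminorm of `T` is the topology generated by the map `T`. -/
theorem seminormTopology_operatorSeminorm {𝕜 E F : Type*} [RCLike 𝕜]
    [NormedAddCommGroup E] [NormedSpace 𝕜 E] [NormedAddCommGroup F] [NormedSpace 𝕜 F]
    (T : E →L[𝕜] F) :
    seminormTopology (operatorSeminorm T) = TopologicalSpace.induced T inferInstance := by
  let i₁ := (operatorSeminorm T).toAddGroupSeminorm.toSeminormedAddCommGroup
  let p₁ : PseudoMetricSpace E := i₁.toPseudoMetricSpace
  let p₂ : PseudoMetricSpace E := PseudoMetricSpace.induced T inferInstance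
  have h : p₁ = p₂ := by
    apply PseudoMetricSpace.ext
    ext x y
    rw [show p₁.dist x y = i₁.norm (-x + y) from i₁.dist_eq x y]
    change ‖T (-x + y)‖ = dist (T x) (T y)
    rw [map_add, map_neg, dist_comm, dist_eq_norm, sub_eq_neg_add]
  change p₁.toUniformSpace.toTopologicalSpace = p₂.toUniformSpace.toTopologicalSpace
  rw [h]

end

/-! Condition (ii) is the hub. If `T` is bounded below on a subspace of finite codimension, it is so
on the closure `H`, and pairing `T` with the quotient map `P : E → E ⧸ H` gives a closed embedding
`(P, T)` (`IsBoundedBelowOn.exists_isClosedEmbedding_prod`). Since `P` has finite rank, it preserves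
relative compactness arguments on bounded sets and is weak-to-norm continuous; this yields (v),
(xii) and (xiii). The link with (i) is the open mapping theorem on a closed complement of the
kernel.

If (ii) fails, every subspace of finite codimension contains unit vectors on which `T` is
arbitrarily small. Mazur's construction selects from them a normalized basic sequence with `‖T (e
n)‖ < 2⁻ⁿ` and bounded biorthogonal functionals `f n`. The nuclear operator `S = ∑ f n ⊗ T (e n)` is
compact and agrees with `T` on every `e n`. This single sequence contradicts (iii), (ix) and (xi)
(`exists_isBasicSequence_isCompactOperator_eq`).

Properness (v) leads to (ix) by extracting convergent subsequences, and (xii) leads to (iii) and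
(xi) through (iv) by Riesz's theorem. -/

/-! ### Lower bounds on subspaces of finite codimension. -/

section UpperSemiFredholm

variable {𝕜 : Type*} [RCLike 𝕜]
  {E : Type u} [NormedAddCommGroup E] [NormedSpace 𝕜 E]
  {F : Type*} [NormedAddCommGroup F] [NormedSpace 𝕜 F]

theorem IsBoundedBelowOn.topologicalClosure {T : E →L[𝕜] F} {G : Submodule 𝕜 E}
    (h : IsBoundedBelowOn T G) : IsBoundedBelowOn T G.topologicalClosure := by
  obtain ⟨c, hc, h⟩ := h
  refine ⟨c, hc, fun x hx => ?_⟩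
  have hcl : IsClosed {x : E | c * ‖x‖ ≤ ‖T x‖} :=
    isClosed_le (by fun_prop) (by fun_prop)
  exact closure_minimal h hcl hx

/-- An operator that is bounded from below on a subspace of finite codimension becomes a closed
embedding when it is paired with a suitable operator of finite rank. -/
theorem IsBoundedBelowOn.exists_isClosedEmbedding_prod [CompleteSpace E] {T : E →L[𝕜] F}
    {G : Submodule 𝕜 E} [FiniteDimensional 𝕜 (E ⧸ G)] (h : IsBoundedBelowOn T G) :
    ∃ (N : Type u) (_ : NormedAddCommGroup N) (_ : NormedSpace 𝕜 N) (_ : FiniteDimensional 𝕜 N)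
      (P : E →L[𝕜] N), IsClosedEmbedding (P.prod T) := by
  -- The quotient is a normed space only for a closed subspace; passing to the closure keeps the
  -- lower bound and finite codimension.
  obtain ⟨c, hc, h⟩ := h.topologicalClosure
  have hfd : FiniteDimensional 𝕜 (E ⧸ G.topologicalClosure) :=
    Submodule.CoFG.of_le G.le_topologicalClosure ‹_›
  generalize hG : G.topologicalClosure = H at *
  have hcl : IsClosed (H : Set E) := hG ▸ G.isClosed_topologicalClosure
  refine ⟨E ⧸ H, inferInstance, inferInstance, hfd, H.mkQL, ?_⟩
  -- Subtract from `x` a representative `m` of its class whose norm is almost the quotient norm; `x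
  -- - m` lies in `H`, where the lower bound applies.
  have key : ∀ x, ‖x‖ ≤ (1 + c⁻¹ * ‖T‖) * ‖H.mkQL x‖ + c⁻¹ * ‖T x‖ := by
    intro x
    refine le_of_forall_pos_le_add fun ε hε => ?_
    have hA : 0 < 1 + c⁻¹ * ‖T‖ := by positivity
    obtain ⟨m, hm, hlt⟩ := Submodule.Quotient.norm_mk_lt (H.mkQL x)
      (div_pos hε hA)
    have hmem : x - m ∈ H := by
      have : H.mkQ m = H.mkQ x := hm
      rw [← Submodule.Quotient.eq]; exact this.symm
    have h1 := h _ hmem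
    have h2 : ‖T (x - m)‖ ≤ ‖T x‖ + ‖T‖ * ‖m‖ := by
      rw [map_sub]; exact (norm_sub_le _ _).trans (by gcongr; exact T.le_opNorm m)
    have h3 : ‖x - m‖ ≤ c⁻¹ * (‖T x‖ + ‖T‖ * ‖m‖) := by
      rw [le_inv_mul_iff₀ hc]; exact h1.trans h2
    have h4 : ‖x‖ ≤ ‖x - m‖ + ‖m‖ := by simpa using norm_add_le (x - m) m
    calc ‖x‖ ≤ (1 + c⁻¹ * ‖T‖) * ‖m‖ + c⁻¹ * ‖T x‖ := by linarith
      _ ≤ (1 + c⁻¹ * ‖T‖) * (‖H.mkQL x‖ + ε / (1 + c⁻¹ * ‖T‖)) + c⁻¹ * ‖T x‖ := by gcongr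
      _ = _ := by field_simp; ring
  refine AntilipschitzWith.isClosedEmbedding
    (ContinuousLinearMap.antilipschitz_of_bound (K := NNReal.mk (1 + c⁻¹ * ‖T‖ + c⁻¹) (by positivity)) _ ?_)
    (ContinuousLinearMap.uniformContinuous _)
  intro x
  refine (key x).trans ?_
  change _ ≤ (1 + c⁻¹ * ‖T‖ + c⁻¹) * _
  have h1 : ‖H.mkQL x‖ ≤ ‖(H.mkQL.prod T) x‖ := le_max_left _ _
  have h2 : ‖T x‖ ≤ ‖(H.mkQL.prod T) x‖ := le_max_right _ _
  rw [add_mul (1 + c⁻¹ * ‖T‖)]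
  gcongr

theorem IsBoundedBelowOn.isClosed_map [CompleteSpace E] {T : E →L[𝕜] F} {G : Submodule 𝕜 E}
    (hG : IsClosed (G : Set E)) (h : IsBoundedBelowOn T G) :
    IsClosed ((G.map (T : E →ₗ[𝕜] F) : Submodule 𝕜 F) : Set F) := by
  obtain ⟨c, hc, h⟩ := h
  have := hG.completeSpace_coe
  have hanti : AntilipschitzWith (NNReal.mk c⁻¹ (by positivity)) (T ∘L G.subtypeL) := by
    refine ContinuousLinearMap.antilipschitz_of_bound _ fun x => ?_
    rw [NNReal.coe_mk, le_inv_mul_iff₀ hc]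
    exact h x x.2
  have := hanti.isClosed_range (ContinuousLinearMap.uniformContinuous _)
  convert this
  ext y
  simp

theorem IsBoundedBelowOn.isUpperSemiFredholm [CompleteSpace E] {T : E →L[𝕜] F}
    {G : Submodule 𝕜 E} [FiniteDimensional 𝕜 (E ⧸ G)] (h : IsBoundedBelowOn T G) :
    IsUpperSemiFredholm T := by
  constructor
  · obtain ⟨c, hc, h⟩ := h
    have hinj : Function.Injective (G.mkQ ∘ₗ (LinearMap.ker (T : E →ₗ[𝕜] F)).subtype) := by
      rw [← LinearMap.ker_eq_bot, LinearMap.ker_eq_bot']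
      intro x hx
      have hxG : (x : E) ∈ G := by simpa using hx
      have h1 := h x hxG
      have h2 : T x = 0 := x.2
      rw [h2, norm_zero] at h1
      have : ‖(x : E)‖ = 0 := le_antisymm (nonpos_of_mul_nonpos_right h1 hc) (norm_nonneg _)
      simpa using this
    exact FiniteDimensional.of_injective _ hinj
  · have h' := h.topologicalClosure
    have hfd : FiniteDimensional 𝕜 (E ⧸ G.topologicalClosure) :=
      Submodule.CoFG.of_le G.le_topologicalClosure ‹_›
    -- The range is the closed image of the closure of `G` plus the finite-dimensional image of a
    -- complement, hence closed.
    obtain ⟨q, hq⟩ := G.topologicalClosure.exists_isCompl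
    have : FiniteDimensional 𝕜 q :=
      (Submodule.quotientEquivOfIsCompl _ q hq).finiteDimensional
    have hc := Submodule.isClosed_sup_finiteDimensional _ (q.map (T : E →ₗ[𝕜] F))
      (h'.isClosed_map G.isClosed_topologicalClosure)
    rw [← Submodule.map_sup, hq.sup_eq_top] at hc
    simpa [LinearMap.coe_range] using hc

theorem IsUpperSemiFredholm.exists_isBoundedBelowOn [CompleteSpace E] [CompleteSpace F]
    {T : E →L[𝕜] F} (h : IsUpperSemiFredholm T) :
    ∃ G : Submodule 𝕜 E, FiniteDimensional 𝕜 (E ⧸ G) ∧ IsBoundedBelowOn T G := by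
  obtain ⟨hfd, hcl⟩ := h
  obtain ⟨G, hG, hcompl⟩ :=
    (Submodule.ClosedComplemented.of_finiteDimensional
      (LinearMap.ker (T : E →ₗ[𝕜] F))).exists_isClosed_isCompl
  refine ⟨G, (Submodule.quotientEquivOfIsCompl G _ hcompl.symm).symm.finiteDimensional, ?_⟩
  have := hG.completeSpace_coe
  have hinj : Function.Injective (T ∘L G.subtypeL) := by
    rw [injective_iff_map_eq_zero]
    intro x hx
    have : (x : E) ∈ LinearMap.ker (T : E →ₗ[𝕜] F) ⊓ G := ⟨hx, x.2⟩
    rw [hcompl.inf_eq_bot] at this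
    simpa using this
  have hrange : Set.range (T ∘L G.subtypeL) = Set.range T := by
    refine Set.Subset.antisymm (by rintro _ ⟨x, rfl⟩; exact ⟨x, rfl⟩) ?_
    rintro _ ⟨x, rfl⟩
    obtain ⟨y, hy, z, hz, rfl⟩ := Submodule.mem_sup.1
      (hcompl.sup_eq_top ▸ Submodule.mem_top : x ∈ LinearMap.ker (T : E →ₗ[𝕜] F) ⊔ G)
    refine ⟨⟨z, hz⟩, ?_⟩
    have : T y = 0 := hy
    simp [this]
  obtain ⟨K, hK⟩ := ContinuousLinearMap.antilipschitz_of_injective_of_isClosed_range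
    (T ∘L G.subtypeL) hinj (hrange ▸ hcl)
  -- `K + 1` instead of `K`, since `K` may be zero.
  refine ⟨(K + 1 : ℝ)⁻¹, by positivity, fun x hx => ?_⟩
  rw [inv_mul_le_iff₀ (by positivity)]
  have h1 : ‖x‖ ≤ K * ‖T x‖ := ZeroHomClass.bound_of_antilipschitz (T ∘L G.subtypeL) hK ⟨x, hx⟩
  linarith [norm_nonneg (T x)]

theorem IsBoundedBelowOn.isCompact_preimage_inter [CompleteSpace E] {T : E →L[𝕜] F}
    {G : Submodule 𝕜 E} [FiniteDimensional 𝕜 (E ⧸ G)] (h : IsBoundedBelowOn T G)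
    {K : Set F} (hK : IsCompact K) : IsCompact (T ⁻¹' K ∩ Metric.closedBall 0 1) := by
  obtain ⟨N, _, _, _, P, hP⟩ := h.exists_isClosedEmbedding_prod
  have : ProperSpace N := FiniteDimensional.proper_rclike 𝕜 N
  refine (hP.isCompact_preimage ((isCompact_closedBall (0 : N) ‖P‖).prod hK)).of_isClosed_subset
    ((hK.isClosed.preimage T.continuous).inter Metric.isClosed_closedBall) ?_
  rintro x ⟨hx, hx1⟩
  refine ⟨?_, hx⟩
  rw [mem_closedBall_zero_iff] at hx1 ⊢
  exact P.unit_le_opNorm x hx1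

/-- Near zero, `(P, T) ∘ S` takes values in a compact product: `P ∘ S` by finite dimension, `T ∘ S`
by hypothesis. A closed embedding pulls this compact set back to a compact set. -/
theorem IsBoundedBelowOn.isCompactOperator_of_comp [CompleteSpace E] {T : E →L[𝕜] F}
    {G : Submodule 𝕜 E} [FiniteDimensional 𝕜 (E ⧸ G)] (h : IsBoundedBelowOn T G)
    {H : Type*} [NormedAddCommGroup H] [NormedSpace 𝕜 H] {S : H →L[𝕜] E}
    (hS : IsCompactOperator (T ∘L S)) : IsCompactOperator S := by
  obtain ⟨N, _, _, _, P, hP⟩ := h.exists_isClosedEmbedding_prod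
  have : ProperSpace N := FiniteDimensional.proper_rclike 𝕜 N
  obtain ⟨K, hK, hK0⟩ := hS
  refine ⟨_, hP.isCompact_preimage ((isCompact_closedBall (0 : N) 1).prod hK), ?_⟩
  have h1 : (P ∘L S) ⁻¹' Metric.closedBall 0 1 ∈ 𝓝 (0 : H) :=
    (P ∘L S).continuous.continuousAt.preimage_mem_nhds
      (by rw [map_zero]; exact Metric.closedBall_mem_nhds _ one_pos)
  filter_upwards [h1, hK0] with x hx hx' using ⟨hx, hx'⟩

theorem continuous_weakTopology_of_finiteDimensional {N : Type*} [NormedAddCommGroup N]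
    [NormedSpace 𝕜 N] [FiniteDimensional 𝕜 N] (P : E →L[𝕜] N) :
    Continuous[weakTopology 𝕜 E, normTopology N] P := by
  let e := (Module.finBasis 𝕜 N).equivFunL
  have h : Continuous fun x : WeakSpace 𝕜 E => e (P ((toWeakSpace 𝕜 E).symm x)) :=
    continuous_pi fun i => WeakBilin.eval_continuous (topDualPairing 𝕜 E).flip
      ((ContinuousLinearMap.proj (R := 𝕜) (φ := fun _ => 𝕜) i ∘L e.toContinuousLinearMap) ∘L P)
  have h' : Continuous fun x : WeakSpace 𝕜 E => P ((toWeakSpace 𝕜 E).symm x) := by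
    simpa [Function.comp_def] using e.symm.continuous.comp h
  exact @Continuous.comp E (WeakSpace 𝕜 E) N (weakTopology 𝕜 E) _ _ _ _ h' continuous_induced_dom

theorem IsBoundedBelowOn.isComplementaryTo_weakTopology [CompleteSpace E] {T : E →L[𝕜] F}
    {G : Submodule 𝕜 E} [FiniteDimensional 𝕜 (E ⧸ G)] (h : IsBoundedBelowOn T G) :
    IsComplementaryTo T (weakTopology 𝕜 E) := by
  obtain ⟨N, _, _, _, P, hP⟩ := h.exists_isClosedEmbedding_prod
  rw [IsComplementaryTo, AreComplementary, seminormTopology_operatorSeminorm]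
  apply le_antisymm
  · have : normTopology E = TopologicalSpace.induced P inferInstance ⊓
        TopologicalSpace.induced T inferInstance := by
      refine hP.isInducing.eq_induced.trans ?_
      change TopologicalSpace.induced _ (TopologicalSpace.induced Prod.fst _ ⊓
        TopologicalSpace.induced Prod.snd _) = _
      rw [induced_inf, induced_compose, induced_compose]
      rfl
    rw [this]
    exact inf_le_inf_right _ (continuous_weakTopology_of_finiteDimensional P).le_induced
  · refine le_inf ?_ T.continuous.le_induced
    exact (toWeakSpaceCLM 𝕜 E).continuous.le_induced

/-- A basic weak neighbourhood of zero constrains finitely many functionals, so it contains their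
common kernel. -/
theorem exists_finiteDimensional_quotient_subset_of_mem_nhds_weakTopology {U : Set E}
    (hU : U ∈ @nhds E (weakTopology 𝕜 E) 0) :
    ∃ G : Submodule 𝕜 E, FiniteDimensional 𝕜 (E ⧸ G) ∧ (G : Set E) ⊆ U := by
  rw [nhds_induced, mem_comap] at hU
  obtain ⟨V, hV, hVU⟩ := hU
  change V ∈ @nhds E (TopologicalSpace.induced
    (fun x y => (topDualPairing 𝕜 E).flip x y) Pi.topologicalSpace) 0 at hV
  rw [nhds_induced] at hV
  obtain ⟨W, hW, hWV⟩ := hV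
  rw [nhds_pi, Filter.mem_pi'] at hW
  obtain ⟨I, t, ht, htW⟩ := hW
  refine ⟨LinearMap.ker (LinearMap.pi fun f : I => ((f : StrongDual 𝕜 E) : E →ₗ[𝕜] 𝕜)),
    Submodule.CoFG.ker _, fun x hx => hVU (hWV (htW fun f hf => ?_))⟩
  have : f x = 0 := congrFun (LinearMap.mem_ker.1 hx) ⟨f, hf⟩
  have h0 := mem_of_mem_nhds (ht f)
  simp only [map_zero] at h0
  change f x ∈ t f
  rw [this]
  exact h0

theorem IsComplementaryTo.exists_isBoundedBelowOn {T : E →L[𝕜] F}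
    (h : IsComplementaryTo T (weakTopology 𝕜 E)) :
    ∃ G : Submodule 𝕜 E, FiniteDimensional 𝕜 (E ⧸ G) ∧ IsBoundedBelowOn T G := by
  rw [IsComplementaryTo, AreComplementary, seminormTopology_operatorSeminorm] at h
  have hb : Metric.ball (0 : E) 1 ∈ @nhds E (weakTopology 𝕜 E) 0 ⊓
      @nhds E (TopologicalSpace.induced T inferInstance) 0 := by
    refine nhds_inf.ge ?_
    rw [h]
    exact Metric.ball_mem_nhds _ one_pos
  rw [Filter.mem_inf_iff] at hb
  obtain ⟨U, hU, V, hV, hUV⟩ := hb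
  obtain ⟨G, hG, hGU⟩ := exists_finiteDimensional_quotient_subset_of_mem_nhds_weakTopology hU
  rw [nhds_induced, mem_comap, map_zero] at hV
  obtain ⟨W, hW, hWV⟩ := hV
  obtain ⟨ε, hε, hεW⟩ := Metric.mem_nhds_iff.1 hW
  refine ⟨G, hG, ε / 2, by positivity, fun x hx => ?_⟩
  by_contra! hlt
  have hx0 : 0 < ‖x‖ := by
    by_contra! h0
    have : x = 0 := by simpa using h0
    simp [this] at hlt
  -- On `G` the weak constraint is void, so a normalized vector with small image would lie in the
  -- open unit ball.
  have hmem : ((‖x‖⁻¹ : ℝ) : 𝕜) • x ∈ Metric.ball (0 : E) 1 := by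
    rw [hUV]
    refine ⟨hGU (G.smul_mem _ hx), hWV (hεW ?_)⟩
    rw [map_smul, mem_ball_zero_iff, norm_smul, RCLike.norm_ofReal, abs_of_pos (by positivity),
      inv_mul_lt_iff₀ hx0]
    nlinarith
  rw [mem_ball_zero_iff, norm_smul, RCLike.norm_ofReal, abs_of_pos (by positivity),
    inv_mul_cancel₀ hx0.ne'] at hmem
  exact lt_irrefl _ hmem

end UpperSemiFredholm

/-! ### Mazur's construction of basic sequences and the compact operator attached to them. -/

section BasicSequence

variable {𝕜 : Type*} [RCLike 𝕜]
  {E : Type u} [NormedAddCommGroup E] [NormedSpace 𝕜 E]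
  {F : Type*} [NormedAddCommGroup F] [NormedSpace 𝕜 F]

/-- Every finite-dimensional subspace is almost orthogonal to a subspace of finite codimension. -/
theorem Submodule.exists_finiteDimensional_quotient_norm_le (V : Submodule 𝕜 E)
    [FiniteDimensional 𝕜 V] :
    ∃ G : Submodule 𝕜 E, FiniteDimensional 𝕜 (E ⧸ G) ∧
      ∀ y ∈ V, ∀ x ∈ G, ‖y‖ ≤ 2 * ‖y + x‖ := by
  have : ProperSpace V := FiniteDimensional.proper_rclike 𝕜 V
  have hdual : ∀ y : V, ∃ g : StrongDual 𝕜 E, ‖g‖ ≤ 1 ∧ g y = ‖(y : E)‖ :=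
    fun y => exists_dual_vector'' 𝕜 (y : E)
  choose g hg1 hgy using hdual
  -- Finitely many norming functionals exceed `1 / 2` somewhere among them at each point of the unit
  -- sphere of `V`; their common kernel is `G`, and `1 / 2` gives the factor `2`.
  obtain ⟨t, -, ht⟩ := (isCompact_sphere (0 : V) 1).elim_nhds_subcover
    (fun y => {z : V | 1 / 2 < ‖g y z‖}) fun y hy => by
      refine IsOpen.mem_nhds (isOpen_lt continuous_const (by fun_prop)) ?_
      have : ‖y‖ = 1 := by simpa using hy
      simp only [Set.mem_ofPred_eq, hgy, RCLike.norm_ofReal, Submodule.norm_coe, this]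
      norm_num
  refine ⟨LinearMap.ker (LinearMap.pi fun f : t => (g f : E →ₗ[𝕜] 𝕜)),
    Submodule.CoFG.ker _, fun y hy x hx => ?_⟩
  rcases eq_or_ne y 0 with rfl | hy0
  · simp
  have hpos : 0 < ‖y‖ := norm_pos_iff.2 hy0
  let z : V := ((‖y‖⁻¹ : ℝ) : 𝕜) • ⟨y, hy⟩
  have hz : z ∈ Metric.sphere (0 : V) 1 := by
    rw [mem_sphere_zero_iff_norm, norm_smul, RCLike.norm_ofReal, abs_of_pos (by positivity)]
    exact inv_mul_cancel₀ hpos.ne'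
  obtain ⟨f, hf, hfz⟩ := Set.mem_iUnion₂.1 (ht hz)
  have hfx : g f x = 0 := congrFun (LinearMap.mem_ker.1 hx) ⟨f, hf⟩
  have h1 : 1 / 2 < ‖y‖⁻¹ * ‖g f y‖ := by
    have : ‖g f z‖ = ‖y‖⁻¹ * ‖g f y‖ := by
      simp [z]
    rw [← this]; exact hfz
  have h2 : ‖g f y‖ ≤ ‖y + x‖ := by
    have := (g f).le_of_opNorm_le (hg1 f) (y + x)
    rwa [map_add, hfx, add_zero, one_mul] at this
  rw [lt_inv_mul_iff₀ hpos] at h1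
  linarith

theorem exists_norm_eq_one_norm_map_lt {T : E →L[𝕜] F}
    (hT : ¬ ∃ G : Submodule 𝕜 E, FiniteDimensional 𝕜 (E ⧸ G) ∧ IsBoundedBelowOn T G)
    {ε : ℝ} (hε : 0 < ε) (G : Submodule 𝕜 E) [hG : FiniteDimensional 𝕜 (E ⧸ G)] :
    ∃ x ∈ G, ‖x‖ = 1 ∧ ‖T x‖ < ε := by
  by_contra! h
  refine hT ⟨G, hG, ε, hε, fun x hx => ?_⟩
  rcases eq_or_ne x 0 with rfl | hx0
  · simp
  have hpos : 0 < ‖x‖ := norm_pos_iff.2 hx0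
  have := h (((‖x‖⁻¹ : ℝ) : 𝕜) • x) (G.smul_mem _ hx) (by
    rw [norm_smul, RCLike.norm_ofReal, abs_of_pos (by positivity), inv_mul_cancel₀ hpos.ne'])
  rw [map_smul, norm_smul, RCLike.norm_ofReal, abs_of_pos (by positivity),
    le_inv_mul_iff₀ hpos] at this
  linarith

/-- If subspaces of finite codimension contain unit vectors with the property `p n` for each `n`,
then a sequence of such vectors can be chosen whose partial sum projections are bounded by `2`. -/
theorem exists_seq_norm_sum_le (p : ℕ → E → Prop)
    (hp : ∀ (n : ℕ) (G : Submodule 𝕜 E), FiniteDimensional 𝕜 (E ⧸ G) → ∃ x ∈ G, p n x) :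
    ∃ e : ℕ → E, (∀ n, p n (e n)) ∧ ∀ (a : ℕ → 𝕜) (m n : ℕ), m ≤ n →
      ‖∑ i ∈ Finset.range m, a i • e i‖ ≤ 2 * ‖∑ i ∈ Finset.range n, a i • e i‖ := by
  choose pick hpick hpickp using hp
  choose N hN hNle using fun (V : Submodule 𝕜 E) (_ : FiniteDimensional 𝕜 V) =>
    V.exists_finiteDimensional_quotient_norm_le
  -- A state holds the span of the vectors chosen so far and a subspace of finite codimension,
  -- almost orthogonal to it, from which all later vectors are drawn.
  let X := {s : Submodule 𝕜 E × Submodule 𝕜 E //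
    FiniteDimensional 𝕜 s.1 ∧ FiniteDimensional 𝕜 (E ⧸ s.2)}
  let v : ℕ → X → E := fun n s => pick n s.1.2 s.2.2
  have hfd : ∀ n (s : X), FiniteDimensional 𝕜 (s.1.1 ⊔ Submodule.span 𝕜 {v n s} : Submodule 𝕜 E) :=
    fun n s => by
      have := s.2.1
      infer_instance
  let S : ℕ → X := fun n => Nat.rec ⟨(⊥, ⊤), inferInstance, Submodule.CoFG.top⟩
    (fun n s => ⟨(s.1.1 ⊔ Submodule.span 𝕜 {v n s},
      s.1.2 ⊓ N (s.1.1 ⊔ Submodule.span 𝕜 {v n s}) (hfd n s)), hfd n s,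
      Submodule.CoFG.inf s.2.2 (hN _ _)⟩) n
  have hS1 : ∀ n, (S (n + 1)).1.1 = (S n).1.1 ⊔ Submodule.span 𝕜 {v n (S n)} := fun n => rfl
  have hS2 : ∀ n, (S (n + 1)).1.2 = (S n).1.2 ⊓ N (S (n + 1)).1.1 (hfd n (S n)) := fun n => rfl
  have hmono : Monotone fun n => (S n).1.1 := monotone_nat_of_le_succ fun n => by
    rw [hS1]; exact le_sup_left
  have hanti : Antitone fun n => (S n).1.2 := antitone_nat_of_succ_le fun n => by
    rw [hS2]; exact inf_le_left
  have hle : ∀ n, ∀ y ∈ (S n).1.1, ∀ x ∈ (S n).1.2, ‖y‖ ≤ 2 * ‖y + x‖ := by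
    rintro (_ | n) y hy x hx
    · have : y = 0 := by simpa [S] using hy
      simp [this]
    · rw [hS2] at hx
      exact hNle _ _ y hy x hx.2
  refine ⟨fun n => v n (S n), fun n => hpickp _ _ _, fun a m n hmn => ?_⟩
  rw [← Finset.sum_range_add_sum_Ico _ hmn]
  refine hle m _ (Submodule.sum_mem _ fun i hi => Submodule.smul_mem _ _ ?_) _
    (Submodule.sum_mem _ fun i hi => Submodule.smul_mem _ _ ?_)
  · refine hmono (Nat.succ_le_of_lt (Finset.mem_range.1 hi)) ?_
    change _ ∈ (S (i + 1)).1.1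
    rw [hS1]
    exact Submodule.mem_sup_right (Submodule.mem_span_singleton_self _)
  · exact hanti (Finset.mem_Ico.1 hi).1 (hpick _ _ _)

theorem Submodule.exists_eq_sum_range_of_mem_span_range {e : ℕ → E} {x : E}
    (hx : x ∈ Submodule.span 𝕜 (Set.range e)) :
    ∃ (a : ℕ → 𝕜) (n : ℕ), (∀ i, n ≤ i → a i = 0) ∧ x = ∑ i ∈ Finset.range n, a i • e i := by
  obtain ⟨c, rfl⟩ := (Finsupp.mem_span_range_iff_exists_finsupp).1 hx
  obtain ⟨n, hn⟩ := c.support.exists_nat_subset_range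
  refine ⟨c, n, fun i hi => ?_, Finsupp.sum_of_support_subset _ hn _ (by simp)⟩
  by_contra h
  exact absurd (Finset.mem_range.1 (hn (Finsupp.mem_support_iff.2 h))) (not_lt.2 hi)

/-- A normalized sequence with bounded partial sum projections has a bounded sequence of
biorthogonal functionals. -/
theorem exists_biorthogonal_of_norm_sum_le {e : ℕ → E} (he : ∀ n, ‖e n‖ = 1) {K : ℝ}
    (hK : ∀ (a : ℕ → 𝕜) (m n : ℕ), m ≤ n →
      ‖∑ i ∈ Finset.range m, a i • e i‖ ≤ K * ‖∑ i ∈ Finset.range n, a i • e i‖) :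
    ∃ f : ℕ → StrongDual 𝕜 E, (∀ n, ‖f n‖ ≤ 2 * K) ∧
      ∀ i j, f i (e j) = (Pi.single j (1 : 𝕜) : ℕ → 𝕜) i := by
  -- A coefficient is the difference of two consecutive partial sums, each at most `K` times the
  -- full norm; hence `2 * K`.
  have hcoef : ∀ (a : ℕ → 𝕜) (n j : ℕ), (∀ i, n ≤ i → a i = 0) →
      ‖a j‖ ≤ 2 * K * ‖∑ i ∈ Finset.range n, a i • e i‖ := by
    intro a n j ha
    have hext : ∀ m, n ≤ m → ∑ i ∈ Finset.range m, a i • e i = ∑ i ∈ Finset.range n, a i • e i := by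
      intro m hm
      refine (Finset.sum_subset (Finset.range_mono hm) fun i _ hi => ?_).symm
      rw [ha i (by simpa using hi), zero_smul]
    have hP : ∀ m, ‖∑ i ∈ Finset.range m, a i • e i‖ ≤
        K * ‖∑ i ∈ Finset.range n, a i • e i‖ := fun m => by
      rw [← hext (max m n) (le_max_right _ _)]
      exact hK a m _ (le_max_left _ _)
    have h1 : ‖a j‖ = ‖∑ i ∈ Finset.range (j + 1), a i • e i - ∑ i ∈ Finset.range j, a i • e i‖ := by
      rw [Finset.sum_range_succ, add_sub_cancel_left, norm_smul, he, mul_one]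
    rw [h1]
    refine (norm_sub_le _ _).trans ?_
    linarith [hP (j + 1), hP j]
  have hli : LinearIndependent 𝕜 e := by
    rw [linearIndependent_iff']
    intro s g hg i hi
    obtain ⟨n, hn⟩ := s.exists_nat_subset_range
    let a : ℕ → 𝕜 := fun i => if i ∈ s then g i else 0
    have h := hcoef a n i fun j hj => if_neg fun hjs =>
      absurd (Finset.mem_range.1 (hn hjs)) (not_lt.2 hj)
    have hsum : ∑ i ∈ Finset.range n, a i • e i = 0 := by
      rw [← hg, ← Finset.sum_subset hn fun j _ hj => by simp [a, hj]]
      exact Finset.sum_congr rfl fun j hj => by simp [a, hj]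
    rw [hsum, norm_zero, mul_zero, norm_le_zero_iff] at h
    simpa [a, hi] using h
  let b := Module.Basis.span hli
  have hb : ∀ i, (b i : E) = e i := fun i =>
    congrArg Subtype.val (Module.Basis.span_apply hli i)
  have hbound : ∀ (j : ℕ) (x : Submodule.span 𝕜 (Set.range e)),
      ‖b.coord j x‖ ≤ 2 * K * ‖x‖ := by
    intro j x
    obtain ⟨a, n, ha, hx⟩ := Submodule.exists_eq_sum_range_of_mem_span_range x.2
    have hx' : x = ∑ i ∈ Finset.range n, a i • b i := by
      apply Subtype.ext
      simp [hx, hb]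
    have : b.coord j x = a j := by
      rw [hx', map_sum]
      simp only [map_smul, Module.Basis.coord_apply, Module.Basis.repr_self, smul_eq_mul,
        Finsupp.single_apply, mul_ite, mul_one, mul_zero, Finset.sum_ite_eq', Finset.mem_range]
      split_ifs with h
      · rfl
      · exact (ha j (not_lt.1 h)).symm
    rw [this, ← Submodule.norm_coe, hx]
    exact hcoef a n j ha
  have hK0 : 0 ≤ 2 * K := by
    have := (norm_nonneg _).trans (hbound 0 (b 0))
    rwa [← Submodule.norm_coe, hb, he, mul_one] at this
  -- Hahn–Banach extends the bounded coordinate functionals from the span to `E`.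
  choose f hf hfn using fun j => exists_extension_norm_eq _ ((b.coord j).mkContinuous _ (hbound j))
  refine ⟨f, fun n => (hfn n).trans_le (LinearMap.mkContinuous_norm_le _ hK0 _), fun i j => ?_⟩
  rw [← hb, hf, LinearMap.mkContinuous_apply, Module.Basis.coord_apply, Module.Basis.repr_self]
  simp [Finsupp.single_apply, Pi.single_apply, eq_comm]

/-- The projections `P n` are eventually the identity at each vector of the span and are uniformly
bounded on its closure, so they converge pointwise to the identity there. -/
theorem isBasicSequence_of_norm_sum_le {e : ℕ → E} {K : ℝ}
    (hK : ∀ (a : ℕ → 𝕜) (m n : ℕ), m ≤ n →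
      ‖∑ i ∈ Finset.range m, a i • e i‖ ≤ K * ‖∑ i ∈ Finset.range n, a i • e i‖)
    {f : ℕ → StrongDual 𝕜 E} (hf : ∀ i j, f i (e j) = (Pi.single j (1 : 𝕜) : ℕ → 𝕜) i) :
    IsBasicSequence 𝕜 e := by
  have hcoef : ∀ (a : ℕ → 𝕜) (n : ℕ), (∀ i, n ≤ i → a i = 0) → ∀ j,
      f j (∑ i ∈ Finset.range n, a i • e i) = a j := by
    intro a n ha j
    simp only [map_sum, map_smul, hf, Pi.single_apply, smul_eq_mul, mul_ite, mul_one, mul_zero,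
      Finset.sum_ite_eq, Finset.mem_range]
    split_ifs with h
    · rfl
    · exact (ha j (not_lt.1 h)).symm
  let P : ℕ → E →L[𝕜] E := fun n => ∑ i ∈ Finset.range n, (f i).smulRight (e i)
  have hP : ∀ n x, P n x = ∑ i ∈ Finset.range n, f i x • e i := fun n x => by simp [P]
  have hPeq : ∀ x ∈ Submodule.span 𝕜 (Set.range e), ∃ N, ∀ n, N ≤ n → P n x = x := by
    intro x hx
    obtain ⟨a, N, ha, rfl⟩ := Submodule.exists_eq_sum_range_of_mem_span_range hx
    refine ⟨N, fun n hn => ?_⟩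
    rw [hP]
    simp only [hcoef a N ha]
    refine (Finset.sum_subset (Finset.range_mono hn) fun i _ hi => ?_).symm
    rw [ha i (by simpa using hi), zero_smul]
  have hPle : ∀ n, ∀ x ∈ closedSpan 𝕜 (Set.range e), ‖P n x‖ ≤ K * ‖x‖ := by
    intro n x hx
    refine closure_minimal (s := (Submodule.span 𝕜 (Set.range e) : Set E))
      (t := {x | ‖P n x‖ ≤ K * ‖x‖}) ?_ (isClosed_le (by fun_prop) (by fun_prop)) hx
    intro y hy
    obtain ⟨N, hN⟩ := hPeq y hy
    have := hK (fun i => f i y) n (max n N) (le_max_left _ _)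
    rwa [← hP, ← hP, hN _ (le_max_right _ _)] at this
  have hlim : ∀ x ∈ closedSpan 𝕜 (Set.range e), Tendsto (fun n => P n x) atTop (𝓝 x) := by
    intro x hx
    rw [Metric.tendsto_atTop]
    intro ε hε
    -- Replacing `x` by `y` costs at most `(|K| + 1) * ‖x - y‖`; no sign of `K` is assumed.
    have hδ : 0 < ε / (|K| + 2) := by positivity
    obtain ⟨y, hy, hxy⟩ := Metric.mem_closure_iff.1 hx _ hδ
    obtain ⟨N, hN⟩ := hPeq y hy
    refine ⟨N, fun n hn => ?_⟩
    rw [dist_eq_norm] at hxy ⊢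
    have h1 : P n x - x = P n (x - y) - (x - y) := by
      rw [map_sub, hN n hn]; abel
    have h2 := hPle n (x - y) (Submodule.sub_mem _ hx
      (Submodule.le_topologicalClosure _ hy))
    rw [lt_div_iff₀ (by positivity)] at hxy
    calc ‖P n x - x‖ ≤ ‖P n (x - y)‖ + ‖x - y‖ := by rw [h1]; exact norm_sub_le _ _
      _ ≤ |K| * ‖x - y‖ + ‖x - y‖ := by
        gcongr
        exact h2.trans (by gcongr; exact le_abs_self K)
      _ < ε := by nlinarith [norm_nonneg (x - y)]
  refine ⟨{
    basis := fun n => ⟨e n, Submodule.le_topologicalClosure _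
      (Submodule.subset_span (Set.mem_range_self n))⟩
    coord := fun n => f n ∘L (closedSpan 𝕜 (Set.range e)).subtypeL
    ortho := fun i j => (hf i j).trans (by congr!)
    expansion := fun x => ?_ }, fun n => rfl⟩
  rw [HasSum, SummationFilter.conditional_filter_eq_map_range, tendsto_map'_iff, tendsto_subtype_rng]
  refine (hlim x x.2).congr fun n => ?_
  simp [hP]

theorem isCompactOperator_smulRight (f : StrongDual 𝕜 E) (y : F) :
    IsCompactOperator (f.smulRight y) := by
  have h : IsCompactOperator (f : E → 𝕜) := by
    refine ⟨Metric.closedBall 0 1, isCompact_closedBall _ _, ?_⟩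
    exact f.continuous.continuousAt.preimage_mem_nhds
      (by rw [map_zero]; exact Metric.closedBall_mem_nhds _ one_pos)
  exact h.clm_comp (ContinuousLinearMap.toSpanSingleton 𝕜 y)

/-- The series `∑ f n ⊗ y n` converges absolutely in operator norm, and a norm limit of finite-rank
operators is compact. -/
theorem exists_isCompactOperator_eq_on_biorthogonal [CompleteSpace F] {e : ℕ → E}
    {f : ℕ → StrongDual 𝕜 E} (hf : ∀ i j, f i (e j) = (Pi.single j (1 : 𝕜) : ℕ → 𝕜) i)
    {C : ℝ} (hC : ∀ n, ‖f n‖ ≤ C) {y : ℕ → F} (hy : Summable fun n => ‖y n‖) :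
    ∃ S : E →L[𝕜] F, IsCompactOperator S ∧ ∀ n, S (e n) = y n := by
  have hsum : Summable fun n => (f n).smulRight (y n) := by
    refine Summable.of_norm_bounded (hy.mul_left C) fun n => ?_
    rw [ContinuousLinearMap.norm_smulRight_apply]
    gcongr
    exact hC n
  refine ⟨∑' n, (f n).smulRight (y n), ?_, fun n => ?_⟩
  · exact isClosed_setOfPred_isCompactOperator.mem_of_tendsto hsum.hasSum
      (Eventually.of_forall fun s => (Submodule.sum_mem (compactOperator (RingHom.id 𝕜) E F)
        fun i _ => isCompactOperator_smulRight (f i) (y i)))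
  · have h := hsum.hasSum.mapL (ContinuousLinearMap.apply 𝕜 F (e n))
    have h2 := hasSum_single (f := fun i => ((f i).smulRight (y i)) (e n)) n fun i hi => by
      simp [hf, hi]
    refine (h.unique h2).trans ?_
    simp [hf]

theorem exists_isBasicSequence_isCompactOperator_eq [CompleteSpace F] {T : E →L[𝕜] F}
    (hT : ¬ ∃ G : Submodule 𝕜 E, FiniteDimensional 𝕜 (E ⧸ G) ∧ IsBoundedBelowOn T G) :
    ∃ e : ℕ → E, IsBasicSequence 𝕜 e ∧ (∀ n, ‖e n‖ = 1) ∧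
      Tendsto (fun n => ‖T (e n)‖) atTop (𝓝 0) ∧
      ∃ S : E →L[𝕜] F, IsCompactOperator S ∧ ∀ n, S (e n) = T (e n) := by
  -- Geometric decay makes the images summable, which serves both for nullity and for the compact
  -- operator.
  obtain ⟨e, he, hK⟩ := exists_seq_norm_sum_le (𝕜 := 𝕜)
    (fun n (x : E) => ‖x‖ = 1 ∧ ‖T x‖ < (1 / 2 : ℝ) ^ n)
    fun n G _ => exists_norm_eq_one_norm_map_lt hT (by positivity) G
  obtain ⟨f, hf1, hf⟩ := exists_biorthogonal_of_norm_sum_le (fun n => (he n).1) hK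
  have hs : Summable fun n => ‖T (e n)‖ :=
    Summable.of_nonneg_of_le (fun _ => norm_nonneg _) (fun n => (he n).2.le)
      summable_geometric_two
  exact ⟨e, isBasicSequence_of_norm_sum_le hK hf, fun n => (he n).1, hs.tendsto_atTop_zero,
    exists_isCompactOperator_eq_on_biorthogonal hf hf1 hs⟩

end BasicSequence

/-! ### Subsequences, tails of basic sequences, and Riesz's theorem. -/

section Characterizations

variable {𝕜 : Type*} [RCLike 𝕜]
  {E : Type u} [NormedAddCommGroup E] [NormedSpace 𝕜 E]
  {F : Type*} [NormedAddCommGroup F] [NormedSpace 𝕜 F]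

theorem IsBasicSequence.not_finiteDimensional {e : ℕ → E} (he : IsBasicSequence 𝕜 e)
    {V : Submodule 𝕜 E} (hV : ∀ n, e n ∈ V) : ¬ FiniteDimensional 𝕜 V := by
  intro hfd
  obtain ⟨b, hb⟩ := he
  have hli : LinearIndependent 𝕜 e := by
    have h := b.linearIndependent.map' (closedSpan 𝕜 (Set.range e)).subtype
      (Submodule.ker_subtype _)
    rwa [show (closedSpan 𝕜 (Set.range e)).subtype ∘ b = e from funext hb] at h
  have hli' : LinearIndependent 𝕜 fun n => (⟨e n, hV n⟩ : V) :=
    LinearIndependent.of_comp V.subtype hli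
  exact not_finite_iff_infinite.2 (inferInstanceAs (Infinite ℕ)) hli'.finite_of_isNoetherian

/-- The tails of a basic sequence intersect trivially. -/
theorem IsBasicSequence.eq_zero_of_forall_mem_closedSpan {e : ℕ → E} (he : IsBasicSequence 𝕜 e)
    {x : E} (hx : ∀ m, x ∈ closedSpan 𝕜 (e '' Set.Ici m)) : x = 0 := by
  obtain ⟨b, hb⟩ := he
  have hx0 : x ∈ closedSpan 𝕜 (Set.range e) :=
    Submodule.topologicalClosure_mono (Submodule.span_mono (Set.image_subset_range _ _)) (hx 0)
  -- Extended to `E`, the `n`-th coordinate vanishes on the tail from `n + 1`; so every coordinate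
  -- of `x` is zero.
  choose g hg _ using fun n => exists_extension_norm_eq _ (b.coord n)
  have hge : ∀ i j, i ≠ j → g i (e j) = 0 := by
    intro i j hij
    rw [← hb, hg, b.ortho]
    simp [hij]
  have hcoord : ∀ n, b.coord n ⟨x, hx0⟩ = 0 := by
    intro n
    rw [← hg]
    have hle : closedSpan 𝕜 (e '' Set.Ici (n + 1)) ≤ LinearMap.ker (g n : E →ₗ[𝕜] 𝕜) := by
      refine Submodule.topologicalClosure_minimal _ (Submodule.span_le.2 ?_) (g n).isClosed_ker
      rintro _ ⟨j, hj, rfl⟩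
      exact hge n j (Nat.lt_of_succ_le hj).ne
    exact hle (hx (n + 1))
  have h := b.tendsto_proj ⟨x, hx0⟩
  simp only [SchauderBasis.proj_apply, hcoord, zero_smul, Finset.sum_const_zero] at h
  exact congrArg Subtype.val (tendsto_nhds_unique h tendsto_const_nhds)

theorem tendsto_subseq_of_isCompact_preimage {T : E →L[𝕜] F}
    (h : ∀ K : Set F, IsCompact K → IsCompact (T ⁻¹' K ∩ Metric.closedBall 0 1))
    {e : ℕ → E} (he : ∀ n, e n ∈ Metric.closedBall (0 : E) 1) {y : F}
    (hy : Tendsto (fun n => T (e n)) atTop (𝓝 y)) :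
    ∃ x ∈ Metric.closedBall (0 : E) 1, ∃ φ : ℕ → ℕ, StrictMono φ ∧
      Tendsto (fun n => e (φ n)) atTop (𝓝 x) := by
  obtain ⟨x, hx, φ, hφ, hlim⟩ := (h _ hy.isCompact_insert_range).tendsto_subseq
    fun n => ⟨Set.mem_insert_of_mem _ (Set.mem_range_self n), he n⟩
  exact ⟨x, hx.2, φ, hφ, hlim⟩

theorem isClosed_image_of_isCompact_preimage {T : E →L[𝕜] F}
    (h : ∀ K : Set F, IsCompact K → IsCompact (T ⁻¹' K ∩ Metric.closedBall 0 1))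
    {A : Set E} (hA : A ⊆ Metric.closedBall 0 1) (hcl : IsClosed A) : IsClosed (T '' A) := by
  refine isClosed_of_closure_subset fun y hy => ?_
  obtain ⟨z, hz, hlim⟩ := mem_closure_iff_seq_limit.1 hy
  choose a ha haz using hz
  replace hlim : Tendsto (fun n => T (a n)) atTop (𝓝 y) := hlim.congr fun n => (haz n).symm
  obtain ⟨x, -, φ, hφ, hx⟩ := tendsto_subseq_of_isCompact_preimage h (fun n => hA (ha n)) hlim
  exact ⟨x, hcl.mem_of_tendsto hx (Eventually.of_forall fun n => ha _),
    tendsto_nhds_unique ((T.continuous.tendsto x).comp hx) (hlim.comp hφ.tendsto_atTop)⟩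

/-- If the images of a null sequence never vanish, closedness forces `0 = T x` for some `x` in the
closure of the sequence; `x` is no term of it, hence a cluster point. Adding small multiples of a
vector outside the kernel secures nonvanishing. -/
theorem tendsto_subseq_of_isClosed_image {T : E →L[𝕜] F} (hT : T ≠ 0)
    (h : ∀ A : Set E, A ⊆ Metric.closedBall 0 1 → IsClosed A → IsClosed (T '' A))
    {e : ℕ → E} (he : ∀ n, ‖e n‖ = 1) (hlim : Tendsto (fun n => ‖T (e n)‖) atTop (𝓝 0)) :
    ∃ φ : ℕ → ℕ, StrictMono φ ∧ ∃ x, Tendsto (fun n => e (φ n)) atTop (𝓝 x) := by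
  obtain ⟨u, hu⟩ : ∃ u, T u ≠ 0 := by
    by_contra! h0
    exact hT (ContinuousLinearMap.ext h0)
  have hupos : 0 < ‖u‖ := norm_pos_iff.2 fun h0 => hu (by rw [h0, map_zero])
  obtain ⟨v, hv, hv1⟩ : ∃ v, T v ≠ 0 ∧ ‖v‖ = 1 := by
    refine ⟨((‖u‖⁻¹ : ℝ) : 𝕜) • u, ?_, ?_⟩
    · rw [map_smul]
      exact smul_ne_zero (by exact_mod_cast (inv_pos.2 hupos).ne') hu
    · rw [norm_smul, RCLike.norm_ofReal, abs_of_pos (by positivity), inv_mul_cancel₀ hupos.ne']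
  classical
  -- Perturb the sequence so that its images do not vanish.
  let t : ℕ → 𝕜 := fun n => if T (e n) = 0 then (((n : ℝ) + 1)⁻¹ : ℝ) else 0
  have htle : ∀ n, ‖t n‖ ≤ ((n : ℝ) + 1)⁻¹ := by
    intro n
    have : 0 ≤ ((n : ℝ) + 1)⁻¹ := by positivity
    by_cases h0 : T (e n) = 0
    · simp only [t, h0, if_true, RCLike.norm_ofReal, abs_of_nonneg this, le_refl]
    · simpa only [t, h0, if_false, norm_zero] using this
  have ht0 : Tendsto t atTop (𝓝 0) := by
    refine squeeze_zero_norm htle ?_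
    simpa using tendsto_one_div_add_atTop_nhds_zero_nat (𝕜 := ℝ)
  -- The factor `2⁻¹` keeps the perturbed vectors in the unit ball.
  let a : ℕ → E := fun n => (2⁻¹ : 𝕜) • (e n + t n • v)
  have ha1 : ∀ n, a n ∈ Metric.closedBall (0 : E) 1 := by
    intro n
    have h1 : ‖t n‖ ≤ 1 := (htle n).trans (inv_le_one_of_one_le₀ (by simp))
    have h2 : ‖e n + t n • v‖ ≤ 2 := by
      refine (norm_add_le _ _).trans ?_
      rw [norm_smul, he, hv1]
      linarith
    rw [mem_closedBall_zero_iff, norm_smul, norm_inv, RCLike.norm_ofNat]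
    linarith
  have hTa : ∀ n, T (a n) ≠ 0 := by
    intro n
    simp only [a, map_smul, map_add]
    refine smul_ne_zero (by norm_num) ?_
    by_cases h0 : T (e n) = 0
    · have : t n ≠ 0 := by
        simp only [t, h0, if_true]
        exact_mod_cast (by positivity : ((n : ℝ) + 1)⁻¹ ≠ 0)
      rw [h0, zero_add]
      exact smul_ne_zero this hv
    · simp [t, h0]
  have hTa0 : Tendsto (fun n => T (a n)) atTop (𝓝 0) := by
    have h1 : Tendsto (fun n => T (e n)) atTop (𝓝 0) := tendsto_zero_iff_norm_tendsto_zero.2 hlim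
    simpa [a] using (h1.add (ht0.smul_const (T v))).const_smul (2⁻¹ : 𝕜)
  have hcl := h (closure (Set.range a))
    (closure_minimal (by rintro _ ⟨n, rfl⟩; exact ha1 n) Metric.isClosed_closedBall)
    isClosed_closure
  obtain ⟨x, hx, hTx⟩ := hcl.mem_of_tendsto hTa0
    (Eventually.of_forall fun n => ⟨a n, subset_closure (Set.mem_range_self n), rfl⟩)
  have hmap : MapClusterPt x atTop a := by
    rw [mapClusterPt_iff_frequently]
    intro s hs
    by_contra hfr
    rw [not_frequently, eventually_atTop] at hfr
    obtain ⟨N, hN⟩ := hfr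
    have hfin : IsClosed (a '' Set.Iio N) := ((Set.finite_Iio N).image a).isClosed
    have hxn : x ∉ a '' Set.Iio N := by
      rintro ⟨n, -, rfl⟩
      exact hTa n hTx
    obtain ⟨_, ⟨hs', hn'⟩, n, rfl⟩ := mem_closure_iff_nhds.1 hx _
      (inter_mem hs (hfin.isOpen_compl.mem_nhds hxn))
    rcases lt_or_ge n N with hn | hn
    · exact hn' ⟨n, hn, rfl⟩
    · exact hN n hn hs'
  obtain ⟨φ, hφ, hφx⟩ := hmap.tendsto_subseq
  refine ⟨φ, hφ, (2 : 𝕜) • x, ?_⟩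
  have h1 := (hφx.const_smul (2 : 𝕜)).sub ((ht0.comp hφ.tendsto_atTop).smul_const v)
  simpa [a, smul_smul] using h1

/-- Otherwise each tail contains a unit vector with image of norm at most `1 / (m + 1)`. A
subsequential limit would lie in every tail, hence be zero, yet have norm one. -/
theorem exists_isBoundedBelowOn_closedSpan {T : E →L[𝕜] F}
    (h : ∀ e : ℕ → E, (∀ n, ‖e n‖ = 1) → Tendsto (fun n => ‖T (e n)‖) atTop (𝓝 0) →
      ∃ φ : ℕ → ℕ, StrictMono φ ∧ ∃ x, Tendsto (fun n => e (φ n)) atTop (𝓝 x))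
    {e : ℕ → E} (he : IsBasicSequence 𝕜 e) :
    ∃ m : ℕ, IsBoundedBelowOn T (closedSpan 𝕜 (e '' Set.Ici m)) := by
  by_contra! hno
  have hex : ∀ m : ℕ, ∃ x ∈ closedSpan 𝕜 (e '' Set.Ici m), ‖x‖ = 1 ∧ ‖T x‖ ≤ 1 / ((m : ℝ) + 1) := by
    intro m
    by_contra! hm
    refine hno m ⟨1 / ((m : ℝ) + 1), by positivity, fun x hx => ?_⟩
    rcases eq_or_ne x 0 with rfl | hx0
    · simp
    have hpos : 0 < ‖x‖ := norm_pos_iff.2 hx0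
    have := hm (((‖x‖⁻¹ : ℝ) : 𝕜) • x) (Submodule.smul_mem _ _ hx) (by
      rw [norm_smul, RCLike.norm_ofReal, abs_of_pos (by positivity), inv_mul_cancel₀ hpos.ne'])
    rw [map_smul, norm_smul, RCLike.norm_ofReal, abs_of_pos (by positivity),
      lt_inv_mul_iff₀ hpos] at this
    linarith
  choose x hx hx1 hxT using hex
  obtain ⟨φ, hφ, z, hz⟩ := h x hx1
    (squeeze_zero (fun _ => norm_nonneg _) hxT tendsto_one_div_add_atTop_nhds_zero_nat)
  have hz0 : z = 0 := he.eq_zero_of_forall_mem_closedSpan fun m => by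
    refine (Submodule.isClosed_topologicalClosure _).mem_of_tendsto hz ?_
    filter_upwards [eventually_ge_atTop m] with n hn
    exact Submodule.topologicalClosure_mono (Submodule.span_mono (Set.image_mono
      (Set.Ici_subset_Ici.2 (hn.trans (hφ.id_le n))))) (hx (φ n))
  have h1 := hz.norm
  simp only [hx1, hz0, norm_zero] at h1
  exact one_ne_zero (tendsto_nhds_unique tendsto_const_nhds h1)

theorem IsBoundedBelowOn.not_tendsto {T : E →L[𝕜] F} {e : ℕ → E} {m : ℕ}
    (h : IsBoundedBelowOn T (closedSpan 𝕜 (e '' Set.Ici m))) (he : ∀ n, ‖e n‖ = 1) :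
    ¬ Tendsto (fun n => ‖T (e n)‖) atTop (𝓝 0) := by
  intro hlim
  obtain ⟨c, hc, h⟩ := h
  refine hc.not_ge (ge_of_tendsto hlim ?_)
  filter_upwards [eventually_ge_atTop m] with n hn
  simpa [he] using h (e n) (Submodule.le_topologicalClosure _
    (Submodule.subset_span ⟨n, hn, rfl⟩))

/-- Applied to the inclusion of `G`, the hypothesis makes that inclusion compact, and Riesz's
theorem concludes. `ULift` only moves `G` into the universe over which `H` ranges. -/
theorem finiteDimensional_of_isCompactOn {T : E →L[𝕜] F}
    (h : ∀ (H : Type (max u w)) [NormedAddCommGroup H] [NormedSpace 𝕜 H] (S : H →L[𝕜] E),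
      IsCompactOperator (T ∘L S) → IsCompactOperator S)
    {G : Submodule 𝕜 E} (hG : IsCompactOn T G) : FiniteDimensional 𝕜 G := by
  let up : ULift.{w} G ≃L[𝕜] G := ContinuousLinearEquiv.ulift
  have hS : IsCompactOperator (T ∘L (G.subtypeL ∘L up.toContinuousLinearMap)) :=
    IsCompactOperator.comp_clm (f := fun x : G => T x) hG up.toContinuousLinearMap
  have hG' : IsCompactOperator G.subtypeL :=
    (h (ULift.{w} G) _ hS).comp_clm up.symm.toContinuousLinearMap
  obtain ⟨K, hK, hK0⟩ := hG'
  obtain ⟨r, hr, hrK⟩ := Metric.mem_nhds_iff.1 hK0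
  -- `G` need not be closed, so compact balls are found in its closure.
  have hsub : Metric.ball (0 : E) r ∩ G.topologicalClosure ⊆ K := by
    refine Metric.isOpen_ball.inter_closure.trans (closure_minimal ?_ hK.isClosed)
    rintro x ⟨hx, hxG⟩
    exact hrK (show (⟨x, hxG⟩ : G) ∈ _ by simpa using hx)
  have hcl : IsClosed (G.topologicalClosure : Set E) := G.isClosed_topologicalClosure
  have hcomp : IsCompact (Metric.closedBall (0 : G.topologicalClosure) (r / 2)) := by
    rw [Subtype.isCompact_iff]
    refine hK.of_isClosed_subset
      (hcl.isClosedEmbedding_subtypeVal.isClosedMap _ Metric.isClosed_closedBall) ?_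
    rintro _ ⟨x, hx, rfl⟩
    refine hsub ⟨?_, x.2⟩
    rw [mem_closedBall_zero_iff, ← Submodule.norm_coe] at hx
    rw [mem_ball_zero_iff]
    linarith
  have := FiniteDimensional.of_isCompact_closedBall 𝕜 (half_pos hr) hcomp
  exact Submodule.finiteDimensional_of_le G.le_topologicalClosure

theorem IsCompactOperator.isCompactOn_of_le_ker {T S : E →L[𝕜] F} (hS : IsCompactOperator S)
    {G : Submodule 𝕜 E} (hG : G ≤ LinearMap.ker ((T - S : E →L[𝕜] F) : E →ₗ[𝕜] F)) :
    IsCompactOn T G := by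
  have h : (fun x : G => T x) = fun x : G => S x :=
    funext fun x => sub_eq_zero.1 (LinearMap.mem_ker.1 (hG x.2))
  rw [IsCompactOn, h]
  exact hS.comp_clm G.subtypeL

end Characterizations

/-! ### The equivalence of the thirteen conditions. -/

theorem mainTheorem3 {𝕜 : Type*} [RCLike 𝕜]
    {E : Type u} [NormedAddCommGroup E] [NormedSpace 𝕜 E] [CompleteSpace E]
    {F : Type*} [NormedAddCommGroup F] [NormedSpace 𝕜 F] [CompleteSpace F]
    (T : E →L[𝕜] F) :
    List.TFAE [
      -- (i)
      IsUpperSemiFredholm T,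
      -- (ii)
      ∃ G : Submodule 𝕜 E, FiniteDimensional 𝕜 (E ⧸ G) ∧ IsBoundedBelowOn T G,
      -- (iii)
      ∀ S : E →L[𝕜] F, IsCompactOperator S →
        FiniteDimensional 𝕜 (LinearMap.ker ((T - S : E →L[𝕜] F) : E →ₗ[𝕜] F)),
      -- (iv)
      ∀ G : Submodule 𝕜 E, ¬ FiniteDimensional 𝕜 G → ¬ IsCompactOn T G,
      -- (v)
      ∀ K : Set F, IsCompact K → IsCompact (T ⁻¹' K ∩ Metric.closedBall 0 1),
      -- (vi)
      (T ≠ 0 ∨ FiniteDimensional 𝕜 E) ∧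
        ∀ A : Set E, A ⊆ Metric.closedBall 0 1 → IsClosed A → IsClosed (T '' A),
      -- (vii)
      ∀ e : ℕ → E, (∀ n, ‖e n‖ = 1) → (∃ y, Tendsto (fun n => T (e n)) atTop (𝓝 y)) →
        ∃ φ : ℕ → ℕ, StrictMono φ ∧ ∃ x, Tendsto (fun n => e (φ n)) atTop (𝓝 x),
      -- (viii)
      ∀ e : ℕ → E, (∀ n, ‖e n‖ = 1) → Tendsto (fun n => operatorSeminorm T (e n)) atTop (𝓝 0) →
        ∃ φ : ℕ → ℕ, StrictMono φ ∧ ∃ x, Tendsto (fun n => e (φ n)) atTop (𝓝 x),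
      -- (ix)
      ¬ ∃ e : ℕ → E, IsBasicSequence 𝕜 e ∧ (∀ n, ‖e n‖ = 1) ∧
        Tendsto (fun n => operatorSeminorm T (e n)) atTop (𝓝 0),
      -- (x)
      ∀ e : ℕ → E, IsBasicSequence 𝕜 e →
        ∃ m : ℕ, IsBoundedBelowOn T (closedSpan 𝕜 (e '' Set.Ici m)),
      -- (xi)
      ∀ e : ℕ → E, IsBasicSequence 𝕜 e → ¬ IsCompactOn T (closedSpan 𝕜 (Set.range e)),
      -- (xii)
      ∀ (H : Type (max u w)) [NormedAddCommGroup H] [NormedSpace 𝕜 H] (S : H →L[𝕜] E),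
        IsCompactOperator (T ∘L S) → IsCompactOperator S,
      -- (xiii)
      IsComplementaryTo T (weakTopology 𝕜 E)] := by
  tfae_have 2 → 1 := fun ⟨_, _, hG⟩ => hG.isUpperSemiFredholm
  tfae_have 1 → 2 := IsUpperSemiFredholm.exists_isBoundedBelowOn
  tfae_have 2 → 13 := fun ⟨_, _, hG⟩ => hG.isComplementaryTo_weakTopology
  tfae_have 13 → 2 := IsComplementaryTo.exists_isBoundedBelowOn
  tfae_have 2 → 5 := fun ⟨_, _, hG⟩ _ hK => hG.isCompact_preimage_inter hK
  tfae_have 2 → 12 := fun ⟨_, _, hG⟩ _ _ _ _ hS => hG.isCompactOperator_of_comp hS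
  tfae_have 5 → 6 := by
    refine fun h => ⟨?_, fun A hA hcl => isClosed_image_of_isCompact_preimage h hA hcl⟩
    refine or_iff_not_imp_left.2 fun hT => ?_
    -- For `T = 0` the preimage of `{0}` is everything, so the unit ball itself is compact.
    have hball := h {0} isCompact_singleton
    have hpre : T ⁻¹' {0} = Set.univ := Set.eq_univ_of_forall fun x => by simp [not_not.1 hT]
    rw [hpre, Set.univ_inter] at hball
    exact FiniteDimensional.of_isCompact_closedBall 𝕜 one_pos hball
  tfae_have 5 → 7 := by
    rintro h e he ⟨y, hy⟩
    obtain ⟨x, -, φ, hφ, hx⟩ := tendsto_subseq_of_isCompact_preimage h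
      (fun n => mem_closedBall_zero_iff.2 (he n).le) hy
    exact ⟨φ, hφ, x, hx⟩
  tfae_have 7 → 8 := fun h e he hlim => h e he ⟨0, tendsto_zero_iff_norm_tendsto_zero.2 hlim⟩
  tfae_have 6 → 8 := by
    rintro ⟨hT | hE, h⟩ e he hlim
    · exact tendsto_subseq_of_isClosed_image hT h he hlim
    · have := FiniteDimensional.proper_rclike 𝕜 E
      obtain ⟨x, -, φ, hφ, hx⟩ := (isCompact_closedBall (0 : E) 1).tendsto_subseq
        fun n => mem_closedBall_zero_iff.2 (he n).le
      exact ⟨φ, hφ, x, hx⟩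
  tfae_have 8 → 10 := fun h _ he => exists_isBoundedBelowOn_closedSpan h he
  tfae_have 10 → 9 := by
    rintro h ⟨e, he, he1, hlim⟩
    obtain ⟨m, hm⟩ := h e he
    exact hm.not_tendsto he1 hlim
  tfae_have 9 → 2 := by
    intro h
    by_contra hT
    obtain ⟨e, he, he1, hlim, -⟩ := exists_isBasicSequence_isCompactOperator_eq hT
    exact h ⟨e, he, he1, hlim⟩
  tfae_have 12 → 4 := fun h G hG hGc => hG (finiteDimensional_of_isCompactOn h hGc)
  tfae_have 4 → 3 := fun h S hS => by
    by_contra hfd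
    exact h _ hfd (hS.isCompactOn_of_le_ker le_rfl)
  tfae_have 4 → 11 := fun h e he => h _ (he.not_finiteDimensional fun n =>
    Submodule.le_topologicalClosure _ (Submodule.subset_span (Set.mem_range_self n)))
  tfae_have 3 → 2 := by
    intro h
    by_contra hT
    obtain ⟨e, he, -, -, S, hS, hSe⟩ := exists_isBasicSequence_isCompactOperator_eq hT
    exact he.not_finiteDimensional (fun n => by simp [hSe]) (h S hS)
  tfae_have 11 → 2 := by
    intro h
    by_contra hT
    obtain ⟨e, he, -, -, S, hS, hSe⟩ := exists_isBasicSequence_isCompactOperator_eq hT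
    refine h e he (hS.isCompactOn_of_le_ker (Submodule.topologicalClosure_minimal _
      (Submodule.span_le.2 ?_) (T - S).isClosed_ker))
    rintro _ ⟨n, rfl⟩
    simp [hSe]
  tfae_finish
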